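/- Let $A_1, A_2, \dots$ be an i.i.d. sequence of random variables with values in $(0,\infty)$, and let $$T_n = A_1^{A_2^{\iddots^{A_n}}}, \qquad n \ge 1.$$ Let $a = \inf(\mathrm{supp}(A_1))$ and $b = \sup(\mathrm{supp}(A_1)) \in (0,\infty]$, where $\mathrm{supp}(A_1)$ is the support of the law of $A_1$. Let $e\star 0 = 1$ and $e \star (n+1) = e^{e\star n}$, and for $x\in[0,\infty]$ let $\log^\star(x) = \inf\{n \in \{0,1,2,\dots\} : e \star n \ge x\}$, with $\log^\star(\infty) = \infty$. Let $W$ be the real principal branch of the Lambert function, that is, for $z \ge -1/e$, $W(z)$ is the unique $w \ge -1$ with $we^w = z$. Suppose that at least one of the following holds: 1. $a > 1$ and $b > e^{1/e}$; 2. $b < e^{-e}$ and $$a \ge \exp\left(W\left(\frac{1}{\ln b}\right)\exp\left(-\frac{1}{W\left(\frac{1}{\ln b}\right)}\right)\right);$$ 3. $a = 1$, $b > e^{1/e}$, and $\mathbb{E}\left[\log^\star\left(\frac{1}{A_1-1}\right)\right] < \infty$, where $\frac{1}{A_1 - 1}$ is read as $\infty$ when $A_1 = 1$. Then $T_n$ diverges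 almost surely, that is, almost surely $T_n$ does not converge to a finite real limit. -/

import Mathlib

open MeasureTheory ProbabilityTheory Filter Topology
open scoped ENNReal

noncomputable section

/-- The finite power tower `x 0 ^ (x 1 ^ (⋯ ^ x (n - 1)))` with `n` entries; the empty tower is `1`.
With `x k = A_{k+1}` this is `T_n = A_1 ^ (A_2 ^ (⋯ ^ A_n))`. -/
def powerTower : (ℕ → ℝ) → ℕ → ℝ
  | _, 0 => 1
  | x, n + 1 => x 0 ^ powerTower (fun k => x (k + 1)) n

/-- Tetration `c ⋆ n`: the power tower of `n` copies of `c`, with `c ⋆ 0 = 1`. -/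
def tetration (c : ℝ) (n : ℕ) : ℝ := powerTower (fun _ => c) n

/-- The iterated logarithm `log⋆ x = inf {n : e ⋆ n ≥ x}`, for `x ∈ [0, ∞]`.
The infimum is taken in `ℕ ∪ {∞}`, so that `log⋆ ∞ = inf ∅ = ∞`. -/
def logStar (x : ℝ≥0∞) : ℕ∞ :=
  ⨅ n ∈ {n : ℕ | x ≤ ENNReal.ofReal (tetration (Real.exp 1) n)}, (n : ℕ∞)

/-- The real principal branch of the Lambert function: for `z ≥ -1/e`, `lambertW z` is the unique
`w ≥ -1` with `w * exp w = z` (for `z < -1/e` the value is meaningless). -/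
def lambertW (z : ℝ) : ℝ := Function.invFunOn (fun w : ℝ => w * Real.exp w) (Set.Ici (-1)) z

/-- The function `x ↦ exp (W (1 / ln x) * exp (-1 / W (1 / ln x)))`, used for `0 < x < e ^ (-e)`. -/
def lambertBound (x : ℝ) : ℝ :=
  Real.exp (lambertW (1 / Real.log x) * Real.exp (-(1 / lambertW (1 / Real.log x))))

/-- The infimum, in `[-∞, ∞]`, of the support of a measure on the line. -/
def supportInf (ν : Measure ℝ) : EReal := sInf ((fun x : ℝ => (x : EReal)) '' ν.support)

/-- The supremum, in `[-∞, ∞]`, of the support of a measure on the line. -/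
def supportSup (ν : Measure ℝ) : EReal := sSup ((fun x : ℝ => (x : EReal)) '' ν.support)

end

/-! Cases 1 and 3 both make `∑ P(A < 1 + 1/(e⋆n))` finite, and then the tower is a.s. unbounded. A
block of `m` entries above some `c > e^{1/e}` makes an inner tower large (`pow_le_powerTower`).
Prepending an entry at least `1 + 1/(e⋆n)` raises its height by one tetration level
(`le_powerTower_add`). Summability keeps the probability of such a climb above a fixed `δ`, whatever
its length `k`. So the tower is unbounded with probability at least `δ`, hence almost surely by a
zero-one law. In case 2 the entries are below `1`, so the tower alternates: even towers stay above
`q` and odd ones below `p < q`, where `p = e^{1/w}`, `q = e^w` and `w = W(1/ln b)`. -/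

theorem powerTower_succ (x : ℕ → ℝ) (n : ℕ) :
    powerTower x (n + 1) = x 0 ^ powerTower (fun k => x (k + 1)) n := rfl

theorem tetration_succ (c : ℝ) (n : ℕ) : tetration c (n + 1) = c ^ tetration c n := rfl

theorem tetration_exp_succ (n : ℕ) :
    tetration (Real.exp 1) (n + 1) = Real.exp (tetration (Real.exp 1) n) := by
  rw [tetration_succ, Real.exp_one_rpow]

theorem natCast_add_one_le_tetration_exp (n : ℕ) : (n : ℝ) + 1 ≤ tetration (Real.exp 1) n := by
  induction n with
  | zero => simp [tetration, powerTower]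
  | succ n ih =>
    rw [tetration_exp_succ]
    push_cast
    linarith [Real.add_one_le_exp (tetration (Real.exp 1) n)]

theorem one_le_tetration_exp (n : ℕ) : 1 ≤ tetration (Real.exp 1) n := by
  have := natCast_add_one_le_tetration_exp n
  have : (0 : ℝ) ≤ n := n.cast_nonneg
  linarith

theorem tetration_exp_monotone : Monotone (tetration (Real.exp 1)) := by
  refine monotone_nat_of_le_succ fun n => ?_
  rw [tetration_exp_succ]
  linarith [Real.add_one_le_exp (tetration (Real.exp 1) n)]

/-! ### Growth and boundedness of deterministic towers -/

/-- A tower whose entries are at least `c > exp (1 / e)` grows at least geometrically. -/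
theorem pow_le_powerTower {c : ℝ} (hc : Real.exp (1 / Real.exp 1) < c) (m : ℕ) :
    ∀ x : ℕ → ℝ, (∀ i < m, c ≤ x i) → (Real.exp 1 * Real.log c) ^ m ≤ powerTower x m := by
  have hc0 : 0 < c := (Real.exp_pos _).trans hc
  have hlog : 0 < Real.log c :=
    lt_trans (by positivity) ((Real.lt_log_iff_exp_lt hc0).2 hc)
  induction m with
  | zero => intro x _; simp [powerTower]
  | succ m ih =>
    intro x hx
    have h := ih (fun k => x (k + 1)) fun i hi => hx (i + 1) (by omega)
    set T := powerTower (fun k => x (k + 1)) m with hT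
    have hT0 : 0 ≤ T := le_trans (by positivity) h
    rw [powerTower_succ, ← hT]
    calc (Real.exp 1 * Real.log c) ^ (m + 1)
        ≤ T * (Real.exp 1 * Real.log c) := by rw [pow_succ]; gcongr
      _ = Real.exp 1 * (Real.log c * T) := by ring
      -- This is `e * s ≤ e^s` at `s = T * log c`, tangency at `s = 1`.
      _ ≤ Real.exp 1 * Real.exp (Real.log c * T - 1) := by
          gcongr
          linarith [Real.add_one_le_exp (Real.log c * T - 1)]
      _ = c ^ T := by rw [← Real.exp_add, Real.rpow_def_of_pos hc0]; ring_nf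
      _ ≤ x 0 ^ T := Real.rpow_le_rpow hc0.le (hx 0 (by omega)) hT0

/-- The form `4(t+2)²` reproduces itself under `t ↦ e^t`: since `log x ≥ 1/(2t)`, the exponent `y
log x` is at least `2(t+2)`, and `e^2 ≥ 6` absorbs the constants. -/
theorem exp_le_rpow_of_one_add_inv_le {t x y : ℝ} (ht : 1 ≤ t) (hx : 1 + 1 / t ≤ x)
    (hy : 4 * (t + 2) ^ 2 ≤ y) : 4 * (Real.exp t + 2) ^ 2 ≤ x ^ y := by
  have ht0 : 0 < t := by linarith
  have hx0 : 0 < x := lt_of_lt_of_le (by positivity) hx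
  have hlog : 1 / (2 * t) ≤ Real.log x := by
    have h1 := Real.one_sub_inv_le_log_of_pos (x := 1 + 1 / t) (by positivity)
    have h2 := Real.log_le_log (by positivity) hx
    have h3 : 1 / (2 * t) ≤ 1 - (1 + 1 / t)⁻¹ := by
      have : 1 - (1 + 1 / t)⁻¹ = 1 / (t + 1) := by field_simp; ring
      rw [this]
      exact one_div_le_one_div_of_le (by positivity) (by linarith)
    linarith
  have hexp : 2 * (t + 2) ≤ Real.log x * y := by
    calc 2 * (t + 2) = 2 * (t + 2) * 1 := by ring
      _ ≤ 1 / (2 * t) * (4 * (t + 2) ^ 2) := by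
          rw [one_div_mul_eq_div, le_div_iff₀ (by positivity)]
          nlinarith
      _ ≤ Real.log x * y :=
          mul_le_mul hlog hy (by positivity) (le_trans (by positivity) hlog)
  have he : (7 : ℝ) ≤ Real.exp 2 := by
    have := Real.exp_one_gt_d9
    have h2 : Real.exp 2 = Real.exp 1 * Real.exp 1 := by rw [← Real.exp_add]; norm_num
    rw [h2]; nlinarith
  have ht1 : 1 ≤ Real.exp t := Real.one_le_exp ht0.le
  calc 4 * (Real.exp t + 2) ^ 2 = (2 * (Real.exp t + 2)) ^ 2 := by ring
    _ ≤ (Real.exp 2 * Real.exp t) ^ 2 := by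
        refine pow_le_pow_left₀ (by positivity) ?_ 2
        nlinarith
    _ = Real.exp (2 * (t + 2)) := by
        rw [← Real.exp_add, ← Real.exp_nat_mul]
        congr 1
        push_cast
        ring
    _ ≤ Real.exp (Real.log x * y) := Real.exp_le_exp.2 hexp
    _ = x ^ y := (Real.rpow_def_of_pos hx0 y).symm

/-- Prepending entries that are not too close to `1` raises the height of a tower by one each. -/
theorem le_powerTower_add (h m k : ℕ) : ∀ x : ℕ → ℝ,
    (∀ i < k, 1 + 1 / tetration (Real.exp 1) (h + (k - 1 - i)) ≤ x i) →
    4 * (tetration (Real.exp 1) h + 2) ^ 2 ≤ powerTower (fun i => x (k + i)) m →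
    4 * (tetration (Real.exp 1) (h + k) + 2) ^ 2 ≤ powerTower x (k + m) := by
  induction k with
  | zero => intro x _ hx; simpa using hx
  | succ k ih =>
    intro x hx hT
    have h1 := ih (fun i => x (i + 1))
      (fun i hi => by
        have := hx (i + 1) (by omega)
        rwa [show k + 1 - 1 - (i + 1) = k - 1 - i by omega] at this)
      (by simpa only [show ∀ i, k + 1 + i = k + i + 1 from fun i => by omega] using hT)
    rw [show k + 1 + m = k + m + 1 by omega, powerTower_succ, ← add_assoc, tetration_exp_succ]
    exact exp_le_rpow_of_one_add_inv_le (one_le_tetration_exp _) (by simpa using hx 0 (by omega)) h1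

/-- For base above `1`, `x 0 ^ ·` is increasing with inverse `logb`. Boundedness thus ignores
finitely many entries, which makes it a tail event. -/
theorem bddAbove_range_powerTower_succ_iff {x : ℕ → ℝ} (hx : ∀ i, 1 < x i) :
    BddAbove (Set.range (powerTower fun k => x (k + 1))) ↔ BddAbove (Set.range (powerTower x)) := by
  have h0 : 0 < x 0 := zero_lt_one.trans (hx 0)
  constructor
  · rintro ⟨M, hM⟩
    refine ⟨max 1 (x 0 ^ M), ?_⟩
    rintro _ ⟨n, rfl⟩
    cases n with
    | zero => exact le_max_left _ _
    | succ n => exact le_max_of_le_right (Real.rpow_le_rpow_of_exponent_le (hx 0).le (hM ⟨n, rfl⟩))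
  · rintro ⟨M, hM⟩
    refine ⟨Real.logb (x 0) M, ?_⟩
    rintro _ ⟨n, rfl⟩
    have h1 : x 0 ^ powerTower (fun k => x (k + 1)) n ≤ M := hM ⟨n + 1, rfl⟩
    exact (Real.le_logb_iff_rpow_le (hx 0) ((Real.rpow_pos_of_pos h0 _).trans_le h1)).2 h1

theorem bddAbove_range_powerTower_add_iff {x : ℕ → ℝ} (hx : ∀ i, 1 < x i) (n : ℕ) :
    BddAbove (Set.range (powerTower fun k => x (k + n))) ↔ BddAbove (Set.range (powerTower x)) := by
  induction n with
  | zero => rfl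
  | succ n ih =>
    rw [← ih, ← bddAbove_range_powerTower_succ_iff fun i => hx (i + n)]
    simp only [show ∀ k, k + 1 + n = k + (n + 1) from fun k => by omega]

/-! ### Oscillation for entries below one -/

/-- A tower trapped by a two-cycle `p < q` does not converge. -/
theorem not_tendsto_powerTower_of_rpow_le {a b p q : ℝ} (ha : 0 < a) (hb : b ≤ 1) (hpq : p < q)
    (hp : 0 ≤ p) (hq : q ≤ 1) (haq : q ≤ a ^ p) (hbp : b ^ q ≤ p) {x : ℕ → ℝ}
    (hx : ∀ i, x i ∈ Set.Icc a b) (l : ℝ) : ¬ Tendsto (powerTower x) atTop (𝓝 l) := by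
  have key : ∀ n, ∀ x : ℕ → ℝ, (∀ i, x i ∈ Set.Icc a b) →
      q ≤ powerTower x (2 * n) ∧ powerTower x (2 * n + 1) ≤ p := by
    have odd_of_even : ∀ n, (∀ x : ℕ → ℝ, (∀ i, x i ∈ Set.Icc a b) → q ≤ powerTower x n) →
        ∀ x : ℕ → ℝ, (∀ i, x i ∈ Set.Icc a b) → powerTower x (n + 1) ≤ p := by
      intro n hn x hx
      have hx0 : 0 < x 0 := ha.trans_le (hx 0).1
      rw [powerTower_succ]
      calc x 0 ^ powerTower (fun k => x (k + 1)) n ≤ x 0 ^ q :=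
            Real.rpow_le_rpow_of_exponent_ge hx0 ((hx 0).2.trans hb) (hn _ fun i => hx (i + 1))
        _ ≤ b ^ q := Real.rpow_le_rpow hx0.le (hx 0).2 (hp.trans hpq.le)
        _ ≤ p := hbp
    intro n
    induction n with
    | zero =>
      have h0 : ∀ x : ℕ → ℝ, (∀ i, x i ∈ Set.Icc a b) → q ≤ powerTower x 0 := fun _ _ => hq
      exact fun x hx => ⟨h0 x hx, odd_of_even 0 h0 x hx⟩
    | succ n ih =>
      have h0 : ∀ x : ℕ → ℝ, (∀ i, x i ∈ Set.Icc a b) → q ≤ powerTower x (2 * (n + 1)) := by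
        intro x hx
        rw [show 2 * (n + 1) = 2 * n + 1 + 1 by ring, powerTower_succ]
        have hx0 : 0 < x 0 := ha.trans_le (hx 0).1
        calc q ≤ a ^ p := haq
          _ ≤ x 0 ^ p := Real.rpow_le_rpow ha.le (hx 0).1 hp
          _ ≤ _ := Real.rpow_le_rpow_of_exponent_ge hx0 ((hx 0).2.trans hb)
              (ih _ fun i => hx (i + 1)).2
      exact fun x hx => ⟨h0 x hx, odd_of_even _ h0 x hx⟩
  intro hl
  have heven : Tendsto (fun n : ℕ => 2 * n) atTop atTop := tendsto_id.const_mul_atTop' two_pos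
  have h1 : q ≤ l := ge_of_tendsto' (hl.comp heven) fun n => (key n x hx).1
  have h2 : l ≤ p := le_of_tendsto' (hl.comp ((tendsto_add_atTop_nat 1).comp heven))
    fun n => (key n x hx).2
  linarith

theorem lambertW_spec {z : ℝ} (hz : -Real.exp (-1) ≤ z) (hz0 : z ≤ 0) :
    -1 ≤ lambertW z ∧ lambertW z * Real.exp (lambertW z) = z := by
  have h : ∃ w ∈ Set.Ici (-1 : ℝ), w * Real.exp w = z := by
    have hc : ContinuousOn (fun w : ℝ => w * Real.exp w) (Set.Icc (-1) 0) := by fun_prop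
    obtain ⟨w, hw, h⟩ := intermediate_value_Icc (by norm_num) hc
      (show z ∈ Set.Icc _ _ from ⟨by simpa using hz, by simpa using hz0⟩)
    exact ⟨w, hw.1, h⟩
  exact ⟨Function.invFunOn_mem h, Function.invFunOn_eq h⟩

theorem not_tendsto_powerTower_of_lambertBound_le {b : ℝ} (hb0 : 0 < b)
    (hb : b < Real.exp (-Real.exp 1)) {x : ℕ → ℝ} (hx : ∀ i, x i ∈ Set.Icc (lambertBound b) b)
    (l : ℝ) : ¬ Tendsto (powerTower x) atTop (𝓝 l) := by
  have hlog : Real.log b < -Real.exp 1 := (Real.log_lt_iff_lt_exp hb0).2 hb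
  have hlog0 : Real.log b < 0 := hlog.trans (by linarith [Real.exp_pos 1])
  have hz : -Real.exp (-1) < 1 / Real.log b := by
    rw [Real.exp_neg, ← one_div, ← one_div_neg_eq_neg_one_div]
    exact one_div_lt_one_div_of_neg_of_lt (by linarith [Real.exp_pos 1]) hlog
  obtain ⟨hw1, hw⟩ := lambertW_spec hz.le (one_div_neg.2 hlog0).le
  set w := lambertW (1 / Real.log b) with hwdef
  have hw0 : w < 0 := by
    by_contra! h
    have : 0 ≤ w * Real.exp w := by positivity
    linarith [one_div_neg.2 hlog0]
  have hw1' : -1 < w := by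
    refine lt_of_le_of_ne hw1 fun h => ?_
    rw [← h] at hw
    linarith
  have hlb : Real.log b * Real.exp w = 1 / w := by
    have := hlog0.ne
    have := hw0.ne
    field_simp
    field_simp at hw
    linarith
  -- With these values `b ^ q = p` and `lambertBound b ^ p = q`. Since `-1 < w < 0`, `1 / w < w`, so
  -- `p < q`.
  refine not_tendsto_powerTower_of_rpow_le (a := lambertBound b) (b := b) (p := Real.exp (1 / w))
    (q := Real.exp w) (Real.exp_pos _) ?_ ?_ (Real.exp_pos _).le (Real.exp_le_one_iff.2 hw0.le)
    ?_ ?_ hx l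
  · exact hb.le.trans (Real.exp_le_one_iff.2 (by linarith [Real.exp_pos 1]))
  · rw [Real.exp_lt_exp, div_lt_iff_of_neg hw0]
    nlinarith
  · rw [lambertBound, ← hwdef, ← Real.exp_mul, mul_assoc, ← Real.exp_add]
    simp
  · rw [Real.rpow_def_of_pos hb0, hlb]

/-! ### Almost sure unboundedness -/

theorem one_sub_sum_le_prod_range_one_sub (u : ℕ → ℝ) (h0 : ∀ i, 0 ≤ u i) (h1 : ∀ i, u i ≤ 1)
    (n : ℕ) : 1 - ∑ i ∈ Finset.range n, u i ≤ ∏ i ∈ Finset.range n, (1 - u i) := by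
  induction n with
  | zero => simp
  | succ n ih =>
    rw [Finset.sum_range_succ, Finset.prod_range_succ]
    have hs : 0 ≤ ∑ i ∈ Finset.range n, u i := Finset.sum_nonneg fun i _ => h0 i
    have := mul_le_mul_of_nonneg_right ih (sub_nonneg.2 (h1 n))
    nlinarith [mul_nonneg hs (h0 n)]

theorem measurable_powerTower {Ω : Type*} {m : MeasurableSpace Ω} (n : ℕ) :
    ∀ A : ℕ → Ω → ℝ, (∀ k, Measurable (A k)) →
      Measurable fun ω => powerTower (fun k => A k ω) n := by
  induction n with
  | zero => intro A _; simp [powerTower]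
  | succ n ih =>
    intro A hA
    simp only [powerTower_succ]
    exact (hA 0).pow (ih (fun k => A (k + 1)) fun k => hA (k + 1))

theorem measurableSet_bddAbove_range_powerTower {Ω : Type*} {m : MeasurableSpace Ω}
    {A : ℕ → Ω → ℝ} (hA : ∀ k, Measurable (A k)) :
    MeasurableSet {ω | BddAbove (Set.range (powerTower fun k => A k ω))} :=
  measurableSet_bddAbove_range fun n => measurable_powerTower n A hA

/-- A lower bound on the probabilities of all the events `E n` bounds the probability that
infinitely many of them occur. -/
theorem le_measure_frequently_of_le {Ω : Type*} [MeasurableSpace Ω] {μ : Measure Ω}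
    [IsFiniteMeasure μ] {E : ℕ → Set Ω} (hE : ∀ n, MeasurableSet (E n)) {δ : ℝ≥0∞}
    (hδ : ∀ n, δ ≤ μ (E n)) : δ ≤ μ {ω | ∃ᶠ n in atTop, ω ∈ E n} := by
  have hset : {ω | ∃ᶠ n in atTop, ω ∈ E n} = ⋂ n, ⋃ k, E (n + k) := by
    ext ω
    simp only [Set.mem_ofPred_eq, frequently_atTop, Set.mem_iInter, Set.mem_iUnion]
    refine forall_congr' fun n => ⟨?_, ?_⟩
    · rintro ⟨k, hk, h⟩
      exact ⟨k - n, by rwa [Nat.add_sub_cancel' hk]⟩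
    · rintro ⟨k, h⟩
      exact ⟨n + k, Nat.le_add_right n k, h⟩
  have hanti : Antitone fun n => ⋃ k, E (n + k) := by
    intro n n' hn
    refine Set.iUnion_subset fun k => ?_
    refine Set.subset_iUnion_of_subset (n' - n + k) ?_
    rw [show n + (n' - n + k) = n' + k by omega]
  rw [hset]
  refine ge_of_tendsto' (tendsto_measure_iInter_atTop
    (fun n => (MeasurableSet.iUnion fun k => hE (n + k)).nullMeasurableSet) hanti
    ⟨0, measure_ne_top _ _⟩) fun n => ?_
  exact (hδ (n + 0)).trans (measure_mono (Set.subset_iUnion (fun k => E (n + k)) 0))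

section

variable {Ω : Type*} [MeasurableSpace Ω] {μ : Measure Ω} {A : ℕ → Ω → ℝ}

/-- Boundedness of a tower with independent entries `> 1` obeys a zero-one law. -/
theorem measure_not_bddAbove_powerTower_eq_zero_or_one (hmeas : ∀ n, Measurable (A n))
    (hindep : iIndepFun A μ) (hone : ∀ n ω, 1 < A n ω) :
    μ {ω | ¬ BddAbove (Set.range (powerTower fun k => A k ω))} = 0 ∨
      μ {ω | ¬ BddAbove (Set.range (powerTower fun k => A k ω))} = 1 := by
  refine measure_zero_or_one_of_measurableSet_limsup_atTop
    (s := fun n => MeasurableSpace.comap (A n) inferInstance)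
    (fun n => (hmeas n).comap_le) hindep ?_
  rw [limsup_eq_iInf_iSup_of_nat, MeasurableSpace.measurableSet_iInf]
  intro n
  simp_rw [← bddAbove_range_powerTower_add_iff (hone · _) n]
  refine MeasurableSet.compl (measurableSet_bddAbove_range_powerTower fun k => ?_)
  refine (comap_measurable (A (k + n))).mono ?_ le_rfl
  exact le_iSup₂_of_le (f := fun i (_ : i ≥ n) => MeasurableSpace.comap (A i) inferInstance)
    (k + n) (Nat.le_add_left n k) le_rfl

variable [IsProbabilityMeasure μ]

/-- The bound `δ` is uniform in `k`, while `h` precedes `m` because the seed length needed depends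
on the starting level `h`. Thresholds run backwards in `i`: the innermost climbing entry faces `t
h`. -/
theorem exists_pos_forall_le_measureReal_climb (hmeas : ∀ n, Measurable (A n))
    (hindep : iIndepFun A μ) (hident : ∀ n, IdentDistrib (A n) (A 0) μ μ) {t : ℕ → ℝ}
    (hsum : ∑' n, μ {ω | A 0 ω < t n} ≠ ∞) {c : ℝ} (hc : μ {ω | c < A 0 ω} ≠ 0) :
    ∃ h, ∀ m, ∃ δ > 0, ∀ k, δ ≤ μ.real {ω | (∀ i < k, t (h + (k - 1 - i)) ≤ A i ω) ∧
      ∀ i < m, c < A (k + i) ω} := by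
  set u : ℕ → ℝ := fun n => μ.real {ω | A 0 ω < t n} with hu
  have hsummable : Summable u := ENNReal.summable_toReal hsum
  -- A tail sum below `1/2` keeps every product of the factors `1 - u (i + h)` above `1/2`.
  obtain ⟨h, hh⟩ : ∃ h, ∑' n, u (n + h) < 1 / 2 :=
    ((_root_.tendsto_sum_nat_add u).eventually_lt_const (by norm_num)).exists
  refine ⟨h, fun m => ⟨1 / 2 * μ.real {ω | c < A 0 ω} ^ m, ?_, fun k => ?_⟩⟩
  · have : 0 < μ.real {ω | c < A 0 ω} := ENNReal.toReal_pos hc (measure_ne_top _ _)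
    positivity
  set S : ℕ → Set ℝ := fun i => if i < k then Set.Ici (t (h + (k - 1 - i))) else Set.Ioi c with hS
  have hSm : ∀ i, MeasurableSet (S i) := fun i => by
    simp only [hS]; split_ifs
    exacts [measurableSet_Ici, measurableSet_Ioi]
  have hset : {ω | (∀ i < k, t (h + (k - 1 - i)) ≤ A i ω) ∧ ∀ i < m, c < A (k + i) ω} =
      ⋂ i ∈ Finset.range (k + m), A i ⁻¹' S i := by
    ext ω
    simp only [Set.mem_ofPred_eq, Set.mem_iInter, Finset.mem_range, Set.mem_preimage, hS]
    constructor
    · rintro ⟨h1, h2⟩ i hi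
      split_ifs with hik
      · exact h1 i hik
      · have := h2 (i - k) (by omega)
        rwa [Nat.add_sub_cancel' (not_lt.1 hik)] at this
    · intro H
      refine ⟨fun i hi => ?_, fun i hi => ?_⟩
      · have := H i (by omega)
        rwa [if_pos hi] at this
      · have := H (k + i) (by omega)
        rwa [if_neg (by omega)] at this
  have hprod : μ.real (⋂ i ∈ Finset.range (k + m), A i ⁻¹' S i) =
      ∏ i ∈ Finset.range (k + m), μ.real (A 0 ⁻¹' S i) := by
    rw [measureReal_def, hindep.measure_inter_preimage_eq_mul _ fun i _ => hSm i,
      ENNReal.toReal_prod]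
    refine Finset.prod_congr rfl fun i _ => ?_
    rw [(hident i).measure_mem_eq (hSm i), measureReal_def]
  have hgood : ∀ n, μ.real (A 0 ⁻¹' Set.Ici (t n)) = 1 - u n := fun n => by
    have : A 0 ⁻¹' Set.Ici (t n) = (A 0 ⁻¹' Set.Iio (t n))ᶜ := by
      rw [← Set.preimage_compl, Set.compl_Iio]
    rw [this, probReal_compl_eq_one_sub ((hmeas 0) measurableSet_Iio)]
    rfl
  rw [hset, hprod, Finset.prod_range_add]
  have hsecond : ∏ i ∈ Finset.range m, μ.real (A 0 ⁻¹' S (k + i)) =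
      μ.real {ω | c < A 0 ω} ^ m := by
    rw [Finset.prod_congr rfl fun i _ => ?_, Finset.prod_const, Finset.card_range]
    rw [hS]
    simp only [if_neg (show ¬ k + i < k by omega)]
    rfl
  have hfirst : ∏ i ∈ Finset.range k, μ.real (A 0 ⁻¹' S i) =
      ∏ i ∈ Finset.range k, (1 - u (i + h)) := by
    rw [← Finset.prod_range_reflect (fun i => 1 - u (i + h))]
    refine Finset.prod_congr rfl fun i hi => ?_
    simp only [hS, if_pos (Finset.mem_range.1 hi)]
    rw [hgood, add_comm h]
  rw [hsecond, hfirst]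
  gcongr
  have h1 := one_sub_sum_le_prod_range_one_sub (fun i => u (i + h)) (fun i => measureReal_nonneg)
    (fun i => measureReal_le_one) k
  have h2 := ((summable_nat_add_iff h).2 hsummable).sum_le_tsum (Finset.range k)
    (fun i _ => measureReal_nonneg)
  linarith

theorem ae_not_bddAbove_powerTower_of_forall_one_lt (hmeas : ∀ n, Measurable (A n))
    (hindep : iIndepFun A μ) (hident : ∀ n, IdentDistrib (A n) (A 0) μ μ)
    (hone : ∀ n ω, 1 < A n ω)
    (hsum : ∑' n, μ {ω | A 0 ω < 1 + 1 / tetration (Real.exp 1) n} ≠ ∞) {c : ℝ}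
    (hc : Real.exp (1 / Real.exp 1) < c) (hcpos : μ {ω | c < A 0 ω} ≠ 0) :
    ∀ᵐ ω ∂μ, ¬ BddAbove (Set.range (powerTower fun k => A k ω)) := by
  obtain ⟨h, H⟩ := exists_pos_forall_le_measureReal_climb hmeas hindep hident hsum hcpos
  have hc0 : 0 < c := (Real.exp_pos _).trans hc
  have hρ : 1 < Real.exp 1 * Real.log c := by
    have := (Real.lt_log_iff_exp_lt hc0).2 hc
    rw [div_lt_iff₀ (Real.exp_pos 1)] at this
    linarith
  obtain ⟨m, hm⟩ := pow_unbounded_of_one_lt (4 * (tetration (Real.exp 1) h + 2) ^ 2) hρ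
  obtain ⟨δ, hδ, H⟩ := H m
  set E : ℕ → Set Ω := fun k => {ω | k ≤ powerTower (fun i => A i ω) (k + m)} with hE
  have hEm : ∀ k, MeasurableSet (E k) := fun k =>
    measurableSet_le measurable_const (measurable_powerTower _ A hmeas)
  have hEδ : ∀ k, ENNReal.ofReal δ ≤ μ (E k) := fun k => by
    rw [ENNReal.ofReal_le_iff_le_toReal (measure_ne_top _ _)]
    refine (H k).trans (measureReal_mono ?_)
    rintro ω ⟨h1, h2⟩
    have h3 := le_powerTower_add h m k (fun i => A i ω) h1
      (hm.le.trans (pow_le_powerTower hc m _ fun i hi => (h2 i hi).le))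
    refine le_trans ?_ h3
    have h4 := natCast_add_one_le_tetration_exp (h + k)
    push_cast at h4
    have h5 : (0 : ℝ) ≤ h := h.cast_nonneg
    have h6 : (0 : ℝ) ≤ k := k.cast_nonneg
    nlinarith
  have hle : ENNReal.ofReal δ ≤ μ {ω | ¬ BddAbove (Set.range (powerTower fun k => A k ω))} := by
    refine (le_measure_frequently_of_le hEm hEδ).trans (measure_mono fun ω hω => ?_)
    rintro ⟨M, hM⟩
    obtain ⟨k, hk, hkE⟩ := frequently_atTop.1 hω (⌊M⌋₊ + 1)
    have h1 : (k : ℝ) ≤ M := le_trans hkE (hM ⟨k + m, rfl⟩)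
    have h2 := Nat.lt_floor_add_one M
    have h3 : ((⌊M⌋₊ + 1 : ℕ) : ℝ) ≤ k := by exact_mod_cast hk
    push_cast at h3
    linarith
  rcases measure_not_bddAbove_powerTower_eq_zero_or_one hmeas hindep hone with h0 | h1
  · rw [h0, nonpos_iff_eq_zero, ENNReal.ofReal_eq_zero] at hle
    linarith
  · have hms : MeasurableSet {ω | ¬ BddAbove (Set.range (powerTower fun k => A k ω))} :=
      (measurableSet_bddAbove_range_powerTower hmeas).compl
    exact (prob_compl_eq_zero_iff hms).2 h1

/-- A tower with i.i.d. entries that exceed some `c > exp (1 / e)` with positive probability and are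
seldom close to `1` is almost surely unbounded. -/
theorem ae_not_bddAbove_powerTower (hmeas : ∀ n, Measurable (A n))
    (hindep : iIndepFun A μ) (hident : ∀ n, IdentDistrib (A n) (A 0) μ μ)
    (hsum : ∑' n, μ {ω | A 0 ω < 1 + 1 / tetration (Real.exp 1) n} ≠ ∞) {c : ℝ}
    (hc : Real.exp (1 / Real.exp 1) < c) (hcpos : μ {ω | c < A 0 ω} ≠ 0) :
    ∀ᵐ ω ∂μ, ¬ BddAbove (Set.range (powerTower fun k => A k ω)) := by
  -- `{A 0 ≤ 1}` lies in every event of a summable series, so it is null.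
  have hone0 : ∀ᵐ ω ∂μ, 1 < A 0 ω := by
    have hle : ∀ n, μ {ω | ¬ 1 < A 0 ω} ≤ μ {ω | A 0 ω < 1 + 1 / tetration (Real.exp 1) n} :=
      fun n => measure_mono fun ω hω => by
        have := one_div_pos.2 (zero_lt_one.trans_le (one_le_tetration_exp n))
        simp only [Set.mem_ofPred_eq, not_lt] at hω ⊢
        linarith
    exact le_antisymm (ge_of_tendsto' (ENNReal.tendsto_atTop_zero_of_tsum_ne_top hsum) hle)
      zero_le
  have hone : ∀ n, ∀ᵐ ω ∂μ, 1 < A n ω := fun n =>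
    (hident n).symm.ae_snd measurableSet_Ioi hone0
  -- Altering entries on a null set makes them exceed `1` everywhere; the value `2` is arbitrary.
  set g : ℝ → ℝ := fun x => if 1 < x then x else 2 with hg
  have hgm : Measurable g := Measurable.ite measurableSet_Ioi measurable_id measurable_const
  have hg1 : ∀ x, 1 < g x := fun x => by
    simp only [hg]; split_ifs with h
    exacts [h, one_lt_two]
  have heq : ∀ n, ∀ᵐ ω ∂μ, g (A n ω) = A n ω := fun n => (hone n).mono fun ω h => if_pos h
  have hae : ∀ p : ℝ → Prop, μ {ω | p (g (A 0 ω))} = μ {ω | p (A 0 ω)} := fun p =>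
    measure_congr ((heq 0).mono fun ω h => by
      change p (g (A 0 ω)) = p (A 0 ω)
      rw [h])
  have := ae_not_bddAbove_powerTower_of_forall_one_lt (A := fun n ω => g (A n ω)) (μ := μ) (c := c)
    (fun n => hgm.comp (hmeas n)) (hindep.comp (fun _ => g) fun _ => hgm)
    (fun n => (hident n).comp hgm) (fun n ω => hg1 _)
    (by simpa only [fun r : ℝ => hae (· < r)] using hsum) hc
    (by simpa only [hae (c < ·)] using hcpos)
  filter_upwards [this, ae_all_iff.2 heq] with ω h1 h2
  simpa only [h2] using h1

end

/-! ### Summability from the hypotheses on the law -/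

/-- For `x ≤ 1` truncation gives `1 / 0 = ∞`, and both sides hold. -/
theorem ofReal_one_div_lt_iff {t x : ℝ} (ht : 0 < t) :
    ENNReal.ofReal t < 1 / ENNReal.ofReal (x - 1) ↔ x < 1 + 1 / t := by
  rw [one_div, ENNReal.lt_inv_iff_lt_inv, ← ENNReal.ofReal_inv_of_pos ht,
    ENNReal.ofReal_lt_ofReal_iff (inv_pos.2 ht), one_div]
  constructor <;> intro h <;> linarith

/-- Only levels `n < logStar x` contribute. Integrated, this turns finite `E[log⋆]` into summable
probabilities. -/
theorem tsum_indicator_le_logStar (x : ℝ≥0∞) :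
    ∑' n : ℕ, (if ENNReal.ofReal (tetration (Real.exp 1) n) < x then (1 : ℝ≥0∞) else 0) ≤
      (logStar x : ℝ≥0∞) := by
  by_cases htop : logStar x = ⊤
  · simp [htop]
  obtain ⟨N, hN⟩ := ENat.ne_top_iff_exists.1 htop
  have hx : x ≤ ENNReal.ofReal (tetration (Real.exp 1) N) := by
    have hlt : logStar x < ((N + 1 : ℕ) : ℕ∞) := by
      rw [← hN]; exact_mod_cast Nat.lt_succ_self N
    obtain ⟨n, hn, hnN⟩ := by simpa only [logStar, iInf_lt_iff] using hlt
    have hnN : n ≤ N := Nat.lt_succ_iff.1 (by exact_mod_cast hnN)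
    exact le_trans hn (ENNReal.ofReal_le_ofReal (tetration_exp_monotone hnN))
  rw [← hN, tsum_eq_sum (s := Finset.range N) fun n hn => ?_]
  · refine (Finset.sum_le_card_nsmul _ _ 1 fun n _ => ?_).trans (by simp)
    split_ifs <;> simp
  · rw [if_neg (not_lt.2 (hx.trans (ENNReal.ofReal_le_ofReal (tetration_exp_monotone ?_))))]
    simpa using hn

section

variable {Ω : Type*} [MeasurableSpace Ω] {μ : Measure Ω} {X : Ω → ℝ}

theorem tsum_measure_lt_le_lintegral_logStar (hX : Measurable X) :
    ∑' n, μ {ω | X ω < 1 + 1 / tetration (Real.exp 1) n} ≤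
      ∫⁻ ω, (logStar (1 / ENNReal.ofReal (X ω - 1)) : ℝ≥0∞) ∂μ := by
  have hms : ∀ n, MeasurableSet {ω | X ω < 1 + 1 / tetration (Real.exp 1) n} := fun n =>
    measurableSet_lt hX measurable_const
  calc ∑' n, μ {ω | X ω < 1 + 1 / tetration (Real.exp 1) n}
      = ∑' n, ∫⁻ ω, {ω | X ω < 1 + 1 / tetration (Real.exp 1) n}.indicator 1 ω ∂μ := by
        simp_rw [lintegral_indicator_one (hms _)]
    _ = ∫⁻ ω, ∑' n, {ω | X ω < 1 + 1 / tetration (Real.exp 1) n}.indicator 1 ω ∂μ :=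
        (lintegral_tsum fun n => (measurable_one.indicator (hms n)).aemeasurable).symm
    _ ≤ _ := by
        refine lintegral_mono fun ω => ?_
        refine le_trans (le_of_eq ?_) (tsum_indicator_le_logStar _)
        refine tsum_congr fun n => ?_
        simp only [ofReal_one_div_lt_iff (zero_lt_one.trans_le (one_le_tetration_exp n)),
          Set.indicator_apply, Set.mem_ofPred_eq, Pi.one_apply]

theorem tsum_measure_lt_ne_top_of_ae_le [IsFiniteMeasure μ] {a : ℝ} (ha : 1 < a)
    (hX : ∀ᵐ ω ∂μ, a ≤ X ω) :
    ∑' n, μ {ω | X ω < 1 + 1 / tetration (Real.exp 1) n} ≠ ∞ := by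
  obtain ⟨N, hN⟩ := exists_nat_gt (1 / (a - 1))
  rw [tsum_eq_sum (s := Finset.range N) fun n hn => ?_]
  · exact ENNReal.sum_ne_top.2 fun n _ => measure_ne_top _ _
  · refine measure_mono_null (fun ω hω => ?_) hX
    have hNn : (N : ℝ) ≤ n := by exact_mod_cast (by simpa using hn : N ≤ n)
    have h1 := natCast_add_one_le_tetration_exp n
    have h2 : 1 / tetration (Real.exp 1) n ≤ a - 1 := by
      rw [one_div_le (by linarith [one_le_tetration_exp n]) (by linarith)]
      linarith
    simp only [Set.mem_ofPred_eq] at hω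
    simp only [Set.mem_compl_iff, Set.mem_ofPred_eq, not_le]
    linarith

theorem ae_supportInf_le (hX : Measurable X) :
    ∀ᵐ ω ∂μ, supportInf (μ.map X) ≤ (X ω : EReal) :=
  (ae_of_ae_map hX.aemeasurable (Measure.support_mem_ae (μ := μ.map X))).mono
    fun ω h => sInf_le ⟨X ω, h, rfl⟩

theorem ae_le_supportSup (hX : Measurable X) :
    ∀ᵐ ω ∂μ, (X ω : EReal) ≤ supportSup (μ.map X) :=
  (ae_of_ae_map hX.aemeasurable (Measure.support_mem_ae (μ := μ.map X))).mono
    fun ω h => le_sSup ⟨X ω, h, rfl⟩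

theorem measure_lt_ne_zero_of_lt_supportSup (hX : Measurable X) {c : ℝ}
    (hc : (c : EReal) < supportSup (μ.map X)) : μ {ω | c < X ω} ≠ 0 := by
  obtain ⟨_, ⟨s, hs, rfl⟩, hcs⟩ := lt_sSup_iff.1 hc
  have := (Measure.mem_support_iff_forall s).1 hs (Set.Ioi c)
    (Ioi_mem_nhds (EReal.coe_lt_coe_iff.1 hcs))
  rw [Measure.map_apply hX measurableSet_Ioi] at this
  exact this.ne'

end

theorem mainTheorem5 {Ω : Type*} [MeasurableSpace Ω] (μ : Measure Ω) [IsProbabilityMeasure μ]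
    (A : ℕ → Ω → ℝ) (hmeas : ∀ n, Measurable (A n)) (hindep : iIndepFun A μ)
    (hident : ∀ n, IdentDistrib (A n) (A 0) μ μ) (hpos : ∀ n, ∀ᵐ ω ∂μ, 0 < A n ω)
    (a b : EReal) (ha : a = supportInf (μ.map (A 0))) (hb : b = supportSup (μ.map (A 0)))
    (hcases :
      (1 < a ∧ ((Real.exp (1 / Real.exp 1) : ℝ) : EReal) < b) ∨
      (b < ((Real.exp (-Real.exp 1) : ℝ) : EReal) ∧
        ((lambertBound b.toReal : ℝ) : EReal) ≤ a) ∨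
      (a = 1 ∧ ((Real.exp (1 / Real.exp 1) : ℝ) : EReal) < b ∧
        ∫⁻ ω, (logStar (1 / ENNReal.ofReal (A 0 ω - 1)) : ℝ≥0∞) ∂μ < ⊤)) :
    ∀ᵐ ω ∂μ, ¬ ∃ l : ℝ, Tendsto (fun n => powerTower (fun k => A k ω) n) atTop (𝓝 l) := by
  have hA : ∀ᵐ ω ∂μ, a ≤ (A 0 ω : EReal) := ha ▸ ae_supportInf_le (hmeas 0)
  have hB : ∀ᵐ ω ∂μ, (A 0 ω : EReal) ≤ b := hb ▸ ae_le_supportSup (hmeas 0)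
  have unbounded : ((Real.exp (1 / Real.exp 1) : ℝ) : EReal) < b →
      ∑' n, μ {ω | A 0 ω < 1 + 1 / tetration (Real.exp 1) n} ≠ ∞ →
      ∀ᵐ ω ∂μ, ¬ ∃ l : ℝ, Tendsto (fun n => powerTower (fun k => A k ω) n) atTop (𝓝 l) := by
    intro hlt hsum
    obtain ⟨c, hc, hcb⟩ := EReal.lt_iff_exists_real_btwn.1 hlt
    refine (ae_not_bddAbove_powerTower hmeas hindep hident hsum (EReal.coe_lt_coe_iff.1 hc)
      (measure_lt_ne_zero_of_lt_supportSup (hmeas 0) (hb ▸ hcb))).mono ?_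
    rintro ω h ⟨l, hl⟩
    exact h hl.bddAbove_range
  rcases hcases with ⟨ha1, hb1⟩ | ⟨hb1, ha1⟩ | ⟨-, hb1, hint⟩
  · obtain ⟨r, hr1, hra⟩ := EReal.lt_iff_exists_real_btwn.1 ha1
    refine unbounded hb1 (tsum_measure_lt_ne_top_of_ae_le (a := r) (by exact_mod_cast hr1) ?_)
    filter_upwards [hA] with ω h
    exact EReal.coe_le_coe_iff.1 (hra.le.trans h)
  -- One positive value of `A 0` below `b` makes `b` a positive real, so `b.toReal` is not a default
  -- value.
  · obtain ⟨ω₀, h₀, h₀pos⟩ := (hB.and (hpos 0)).exists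
    have hbot : b ≠ ⊥ := fun h => by simp [h] at h₀
    lift b to ℝ using ⟨hb1.ne_top, hbot⟩
    have hb0 : 0 < b := h₀pos.trans_le (EReal.coe_le_coe_iff.1 h₀)
    have hIcc0 : ∀ᵐ ω ∂μ, A 0 ω ∈ Set.Icc (lambertBound b) b := by
      filter_upwards [hA, hB] with ω h1 h2
      exact ⟨EReal.coe_le_coe_iff.1 (ha1.trans h1), EReal.coe_le_coe_iff.1 h2⟩
    have hIcc : ∀ n, ∀ᵐ ω ∂μ, A n ω ∈ Set.Icc (lambertBound b) b := fun n =>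
      (hident n).symm.ae_snd measurableSet_Icc hIcc0
    filter_upwards [ae_all_iff.2 hIcc] with ω h
    rintro ⟨l, hl⟩
    exact not_tendsto_powerTower_of_lambertBound_le hb0 (EReal.coe_lt_coe_iff.1 hb1) h l hl
  · exact unbounded hb1 ((tsum_measure_lt_le_lintegral_logStar (hmeas 0)).trans_lt hint).ne
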